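/- For binary strings, a description method is a partial computable map $D:\{0,1\}^*\to\{0,1\}^*$, and $C_D(x)=\min\{|p| : D(p)=x\}$ (with $C_D(x)=\infty$ if no such $p$ exists). $D$ is optimal if for every description method $D'$ there is a constant $c$ with $C_D(x)\le C_{D'}(x)+c$ for all $x$. Fix any optimal $D$ and let $C=C_D$ be the plain Kolmogorov complexity. Let $\mathbf 0'$ be the universal enumerable set (the halting problem), let $\mu$ be the uniform Bernoulli measure on $\{0,1\}^{\mathbb N}$, and let $\Omega_x$ be the set of infinite binary sequences with prefix $x$. A sequence $\omega\in\{0,1\}^{\mathbb N}$ is Martin-Löf random relative to $\mathbf 0'$ ($2$-random) if there is no $\mathbf 0'$-enumerable set $U\subseteq\mathbb N\times\{0,1\}^*$ such that, with $U_n=\bigcup_{(n,x)\in U}\Omega_x$, one has $\mu(U_n)\le 2^{-n}$ and $\omega\in U_n$ for all $n\in\mathbb N$. Theorem. A sequence $\omega=\omega_0\omega_1\omega_2\ldots\in\{0,1\}^{\mathbb N}$ is Martin-Löf random relative to $\mathbf 0'$ if and only if there exists $c\in\mathbb N$ such that $$C(\omega_0\omega_1\ldots\omega_{n-1})\ge n-c$$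 for infinitely many $n$. -/

import Mathlib

open MeasureTheory

namespace AlgorithmicRandomness

/-! ### Plain Kolmogorov complexity -/

/-- The plain complexity of `x` with respect to a description method `D` (a partial map from
binary strings, the descriptions, to binary strings): the length of a shortest description of `x`,
with value `⊤` if there is none. -/
noncomputable def complexity (D : List Bool →. List Bool) (x : List Bool) : ℕ∞ :=
  ⨅ p ∈ {p : List Bool | x ∈ D p}, (p.length : ℕ∞)

/-- A description method is optimal if it is partial computable and its complexity is minimal,
up to an additive constant, among all partial computable description methods. -/
def IsOptimal (D : List Bool →. List Bool) : Prop :=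
  Partrec D ∧ ∀ D' : List Bool →. List Bool, Partrec D' →
    ∃ c : ℕ, ∀ x : List Bool, complexity D x ≤ complexity D' x + c

/-- A universal description method: `1ᵉ 0 q` describes the output of the `e`-th partial computable
function on `q`. -/
def univMethod : List Bool →. List Bool := fun p =>
  ((Denumerable.ofNat Nat.Partrec.Code (p.idxOf false)).eval
      (Encodable.encode (p.drop (p.idxOf false + 1)))).bind
    fun m => (Encodable.decode (α := List Bool) m : Part (List Bool))

/-- Optimal description methods exist. -/
theorem isOptimal_univMethod : IsOptimal univMethod := by
  constructor
  · have hi : Computable fun p : List Bool => p.idxOf false :=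
      ((Primrec.list_idxOf (α := Bool)).comp (Primrec.const false) Primrec.id).to_comp
    have hd : Computable fun p : List Bool => p.drop (p.idxOf false + 1) :=
      (Primrec.list_drop.to_comp).comp (Computable.succ.comp hi) Computable.id
    exact ((Nat.Partrec.Code.eval_part.comp ((Computable.ofNat Nat.Partrec.Code).comp hi)
      (Computable.encode.comp hd)).bind
      ((Computable.decode.comp Computable.snd).ofOption).to₂)
  · intro D' hD'
    obtain ⟨k, hk⟩ := Nat.Partrec.Code.exists_code.1 hD'
    refine ⟨Encodable.encode k + 1, fun x => ?_⟩
    by_cases hx : ∃ p, x ∈ D' p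
    · simp only [complexity, ENat.iInf_add]
      have : Nonempty (List Bool) := ⟨[]⟩
      refine le_iInf fun p => ?_
      by_cases hp : x ∈ D' p
      · simp only [Set.mem_ofPred_eq, hp, iInf_pos]
        have hi : (List.replicate (Encodable.encode k) true ++ false :: p).idxOf false
            = Encodable.encode k := by
          rw [List.idxOf_append_of_notMem (by simp)]; simp
        refine (iInf₂_le (List.replicate (Encodable.encode k) true ++ false :: p) ?_).trans ?_
        · simp only [univMethod, hi]
          have : List.drop (Encodable.encode k + 1)
              (List.replicate (Encodable.encode k) true ++ false :: p) = p := by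
            simp [List.drop_append]
          simp [this, hk, hp]
        · simp; ring_nf; rfl
      · simp [hp]
    · push Not at hx
      simp [complexity, hx]

/-! ### Cantor space -/

/-- The string `ω₀ ω₁ … ω_{n-1}`. -/
def initialSegment (ω : ℕ → Bool) (n : ℕ) : List Bool :=
  (List.range n).map ω

/-- The interval of all infinite binary sequences that have the prefix `x`. -/
def cylinder (x : List Bool) : Set (ℕ → Bool) :=
  {ω | initialSegment ω x.length = x}

/-- The uniform Bernoulli measure (fair coin tossing) on infinite binary sequences. -/
noncomputable def uniformMeasure : Measure (ℕ → Bool) :=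
  Measure.infinitePi fun _ : ℕ => (PMF.uniformOfFintype Bool).toMeasure

/-! ### Oracles and relative Martin-Löf randomness -/

/-- The characteristic function of a set of natural numbers, as an oracle. -/
noncomputable def oracle (A : Set ℕ) : ℕ →. ℕ :=
  fun n => Part.some (A.indicator 1 n)

/-- `p` is enumerable relative to `A`: it is the domain of a partial function that is computable
with oracle `A`. -/
def EnumerableIn {α : Type*} [Primcodable α] (A : Set ℕ) (p : α → Prop) : Prop :=
  RecursiveIn {oracle A} fun a : α => Part.assert (p a) fun _ => Part.some ()

/-- The open set of sequences that is the `n`-th section of `U ⊆ ℕ × {0,1}^*`. -/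
def openSection (U : Set (ℕ × List Bool)) (n : ℕ) : Set (ℕ → Bool) :=
  ⋃ x ∈ {x : List Bool | (n, x) ∈ U}, cylinder x

/-- A Martin-Löf test relative to `A`: a uniformly `A`-enumerable sequence of `A`-effectively
open sets, the `n`-th of uniform measure at most `2⁻ⁿ`. -/
def IsMartinLofTestIn (A : Set ℕ) (U : Set (ℕ × List Bool)) : Prop :=
  EnumerableIn A (fun a => a ∈ U) ∧ ∀ n : ℕ, uniformMeasure (openSection U n) ≤ 2⁻¹ ^ n

/-- `ω` is Martin-Löf random relative to `A` if no Martin-Löf test relative to `A` covers it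
at all levels. -/
def IsMartinLofRandomIn (A : Set ℕ) (ω : ℕ → Bool) : Prop :=
  ∀ U : Set (ℕ × List Bool), IsMartinLofTestIn A U → ω ∉ ⋂ n : ℕ, openSection U n

/-- `0'`, the universal enumerable set (the halting problem): the codes of those pairs `(e, m)`
for which the `e`-th partial computable function is defined at `m`. -/
def zeroJump : Set ℕ :=
  {n | ((Denumerable.ofNat Nat.Partrec.Code n.unpair.1).eval n.unpair.2).Dom}

end AlgorithmicRandomness

/-! Enumerability in `zeroJump` amounts to being `Σ₂` (`EnumerableIn.isSigma2`,
`IsSigma2.enumerableIn`), so both directions work with predicates `∃ n, ∀ m, R` and `R` primitive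
recursive.

Sequences caught by a test have compressible prefixes. At stage `i`, a `Σ₂` open set of measure at
most `2⁻²ᵉ` is approximated by the candidate intervals not yet refuted, trimmed to at most `2 ^ (i -
2e)` strings of length `i`. From some stage on trimming does not lose a given point `ω` of the set
(`exists_forall_inTrimmed`), so almost every prefix of `ω` is described by its position, in `i - 2e`
bits, and `e + 1` bits for `e`. As `e` is arbitrary, no constant `c` works for infinitely many
lengths.

Conversely, suppose that for every `c` almost all prefixes of `ω` have complexity below `n - c - 1`.
Then `ω` lies in the lower limit of enumerable open sets `Vₙ` of measure at most `2⁻⁽ᶜ⁺¹⁾`. The sets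
`⋂_{n ≥ k} Vₙ` need not be open, so finite intersections `V_k ∩ … ∩ V_M` are used instead. For large
`M` these exceed the infinite intersection by arbitrarily little measure, and the infinite one lies
inside every `Vᵢ`, `i ≥ k`. Hence, if the measure of the cover together with any later `Vᵢ` is kept
bounded, adding such a finite intersection costs only the excess (`exists_isAffordable`). Whether an
addition is affordable is a `Π₁` question, so the cover is enumerable in the halting problem
(`isSigma2_coverStrings`). -/

namespace AlgorithmicRandomness

/-! ### Closure properties of primitive recursive and enumerable predicates -/

section Primrec

variable {α β γ σ : Type*} [Primcodable α] [Primcodable β] [Primcodable γ] [Primcodable σ]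

theorem primrecPred_forall_lt {p : α × ℕ → Prop} {f : α → ℕ} (hp : PrimrecPred p)
    (hf : Primrec f) : PrimrecPred fun a => ∀ k < f a, p (a, k) := by
  have h : PrimrecRel fun (k : ℕ) (a : α) => p (a, k) :=
    hp.comp (Primrec.snd.pair Primrec.fst)
  exact (h.forall_mem_list.comp (Primrec.list_range.comp hf) Primrec.id).of_eq fun a => by simp

theorem primrecPred_exists_lt {p : α × ℕ → Prop} {f : α → ℕ} (hp : PrimrecPred p)
    (hf : Primrec f) : PrimrecPred fun a => ∃ k < f a, p (a, k) := by
  have h : PrimrecRel fun (k : ℕ) (a : α) => p (a, k) :=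
    hp.comp (Primrec.snd.pair Primrec.fst)
  exact (h.exists_mem_list.comp (Primrec.list_range.comp hf) Primrec.id).of_eq fun a => by simp

theorem primrecPred_exists_mem_option {p : α × β → Prop} {o : α → Option β}
    (hp : PrimrecPred p) (ho : Primrec o) : PrimrecPred fun a => ∃ b ∈ o a, p (a, b) := by
  classical
  have h : Primrec₂ fun (a : α) (b : β) => decide (p (a, b)) := hp.decide
  refine Primrec.primrecPred ((Primrec.option_casesOn ho (Primrec.const false) h).of_eq ?_)
  intro a
  cases h : o a <;> simp

theorem primrecPred_forall_mem_option {p : α × β → Prop} {o : α → Option β}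
    (hp : PrimrecPred p) (ho : Primrec o) : PrimrecPred fun a => ∀ b ∈ o a, p (a, b) :=
  (primrecPred_exists_mem_option hp.not ho).not.of_eq fun a => by push Not; rfl

/-- A recursively enumerable predicate is the increasing union of its primitive recursive
stages. -/
theorem exists_primrec_stages {p : α → Prop} (hp : REPred p) :
    ∃ S : α × ℕ → Prop, PrimrecPred S ∧ (∀ a s t, s ≤ t → S (a, s) → S (a, t)) ∧
      ∀ a, p a ↔ ∃ t, S (a, t) := by
  obtain ⟨c, hc⟩ := Nat.Partrec.Code.exists_code.1 hp
  refine ⟨fun x => (c.evaln x.2 (Encodable.encode x.1)).isSome = true, ?_, ?_, ?_⟩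
  · have : Primrec fun x : α × ℕ => (c.evaln x.2 (Encodable.encode x.1)).isSome :=
      Primrec.option_isSome.comp (Nat.Partrec.Code.primrec_evaln.comp
        ((Primrec.snd.pair (Primrec.const c)).pair (Primrec.encode.comp Primrec.fst)))
    exact Primrec.primrecPred (this.of_eq fun x => by simp)
  · intro a s t hst h
    obtain ⟨y, hy⟩ := Option.isSome_iff_exists.1 h
    exact Option.isSome_iff_exists.2 ⟨y, Nat.Partrec.Code.evaln_mono hst hy⟩
  · intro a
    have h1 : p a ↔ (c.eval (Encodable.encode a)).Dom := by
      rw [hc]; simp [Part.assert]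
    rw [h1, Part.dom_iff_mem]
    simp only [Nat.Partrec.Code.evaln_complete, Option.isSome_iff_exists, Option.mem_def]
    exact exists_comm

theorem rePred_exists_nat {p : α × ℕ → Prop} (hp : PrimrecPred p) :
    REPred fun a => ∃ n, p (a, n) := by
  classical
  have h : Computable₂ fun (a : α) (n : ℕ) => decide (p (a, n)) := hp.decide.to_comp
  refine (Partrec.rfind h.partrec₂).dom_re.of_eq fun a => ?_
  rw [Part.dom_iff_mem]
  constructor
  · rintro ⟨n, hn⟩
    exact ⟨n, by simpa using Nat.rfind_spec hn⟩
  · rintro ⟨n, hn⟩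
    obtain ⟨m, hm, -⟩ := Nat.rfind_min' (p := fun n => decide (p (a, n))) (m := n)
      (by simpa using hn)
    exact ⟨m, hm⟩

theorem rePred_exists {p : α × β → Prop} (hp : REPred p) : REPred fun a => ∃ b, p (a, b) := by
  obtain ⟨S, hS, -, h⟩ := exists_primrec_stages hp
  have hb : PrimrecPred fun x : α × ℕ =>
      ∃ b ∈ (Encodable.decode x.2.unpair.1 : Option β), S ((x.1, b), x.2.unpair.2) := by
    have hn : Primrec fun x : α × ℕ => x.2.unpair := Primrec.unpair.comp Primrec.snd
    refine primrecPred_exists_mem_option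
      (p := fun y : (α × ℕ) × β => S ((y.1.1, y.2), y.1.2.unpair.2)) ?_
      (Primrec.decode.comp (Primrec.fst.comp hn))
    exact hS.comp (((Primrec.fst.comp Primrec.fst).pair Primrec.snd).pair
      ((Primrec.snd.comp hn).comp Primrec.fst))
  refine (rePred_exists_nat hb).of_eq fun a => ?_
  simp only [h]
  constructor
  · rintro ⟨n, b, -, hb⟩
    exact ⟨b, _, hb⟩
  · rintro ⟨b, t, hb⟩
    -- Dovetailing: one number codes both the witness and the stage at which it is accepted.
    exact ⟨Nat.pair (Encodable.encode b) t, b, by simp, by simpa using hb⟩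

end Primrec

/-! ### Predicates at the second existential level of the arithmetical hierarchy -/

section Sigma2

variable {α β γ : Type*} [Primcodable α] [Primcodable β] [Primcodable γ]

/-- `p a` has the form `∃ n, ∀ m, R a n m` with `R` primitive recursive. -/
def IsSigma2 (p : α → Prop) : Prop :=
  ∃ R : α × ℕ × ℕ → Prop, PrimrecPred R ∧ ∀ a, p a ↔ ∃ n, ∀ m, R (a, n, m)

theorem IsSigma2.of_eq {p q : α → Prop} (hp : IsSigma2 p) (h : ∀ a, p a ↔ q a) : IsSigma2 q :=
  (funext fun a => propext (h a) : p = q) ▸ hp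

theorem isSigma2_of_primrec {p : α → Prop} {R : α × β × γ → Prop} (hR : PrimrecPred R)
    (h : ∀ a, p a ↔ ∃ b, ∀ c, R (a, b, c)) : IsSigma2 p := by
  refine ⟨fun x => ∃ b ∈ (Encodable.decode x.2.1 : Option β),
    ∀ c ∈ (Encodable.decode x.2.2 : Option γ), R (x.1, b, c), ?_, fun a => ?_⟩
  · refine primrecPred_exists_mem_option (p := fun y : (α × ℕ × ℕ) × β =>
      ∀ c ∈ (Encodable.decode y.1.2.2 : Option γ), R (y.1.1, y.2, c)) ?_
      (Primrec.decode.comp (Primrec.fst.comp Primrec.snd))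
    refine primrecPred_forall_mem_option (p := fun z : ((α × ℕ × ℕ) × β) × γ =>
      R (z.1.1.1, z.1.2, z.2)) ?_
      (Primrec.decode.comp (Primrec.snd.comp (Primrec.snd.comp Primrec.fst)))
    exact hR.comp ((Primrec.fst.comp (Primrec.fst.comp Primrec.fst)).pair
      ((Primrec.snd.comp Primrec.fst).pair Primrec.snd))
  · rw [h]
    constructor
    · rintro ⟨b, hb⟩
      exact ⟨Encodable.encode b, fun m => ⟨b, by simp, fun c _ => hb c⟩⟩
    · rintro ⟨n, hn⟩
      -- The outer witness is decoded inside the universal quantifier, but decoding is a function,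
      -- so every `m` yields the same `b`.
      obtain ⟨b, hb, -⟩ := hn 0
      refine ⟨b, fun c => ?_⟩
      obtain ⟨b', hb', h'⟩ := hn (Encodable.encode c)
      obtain rfl : b = b' := Option.mem_unique hb hb'
      exact h' c (by simp)

theorem isSigma2_of_primrecPred {p : α → Prop} (hp : PrimrecPred p) : IsSigma2 p :=
  ⟨fun x => p x.1, hp.comp Primrec.fst, fun _ => by simp⟩

theorem IsSigma2.comp {p : β → Prop} (hp : IsSigma2 p) {f : α → β} (hf : Primrec f) :
    IsSigma2 fun a => p (f a) := by
  obtain ⟨R, hR, h⟩ := hp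
  exact ⟨fun x => R (f x.1, x.2), hR.comp ((hf.comp Primrec.fst).pair Primrec.snd),
    fun a => h _⟩

theorem IsSigma2.and {p q : α → Prop} (hp : IsSigma2 p) (hq : IsSigma2 q) :
    IsSigma2 fun a => p a ∧ q a := by
  obtain ⟨R, hR, h⟩ := hp
  obtain ⟨Q, hQ, h'⟩ := hq
  refine isSigma2_of_primrec (β := ℕ × ℕ) (γ := ℕ)
    (R := fun x => R (x.1, x.2.1.1, x.2.2) ∧ Q (x.1, x.2.1.2, x.2.2)) ?_ fun a => ?_
  · have hm : Primrec fun x : α × (ℕ × ℕ) × ℕ => x.2.2 := Primrec.snd.comp Primrec.snd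
    have hn : Primrec fun x : α × (ℕ × ℕ) × ℕ => x.2.1 := Primrec.fst.comp Primrec.snd
    exact (hR.comp (Primrec.fst.pair ((Primrec.fst.comp hn).pair hm))).and
      (hQ.comp (Primrec.fst.pair ((Primrec.snd.comp hn).pair hm)))
  · rw [h, h']
    constructor
    · rintro ⟨⟨n, hn⟩, k, hk⟩
      exact ⟨(n, k), fun m => ⟨hn m, hk m⟩⟩
    · rintro ⟨⟨n, k⟩, hn⟩
      exact ⟨⟨n, fun m => (hn m).1⟩, k, fun m => (hn m).2⟩

theorem IsSigma2.exists {p : α × β → Prop} (hp : IsSigma2 p) : IsSigma2 fun a => ∃ b, p (a, b) := by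
  obtain ⟨R, hR, h⟩ := hp
  refine isSigma2_of_primrec (β := β × ℕ) (γ := ℕ)
    (R := fun x => R ((x.1, x.2.1.1), x.2.1.2, x.2.2)) ?_ fun a => ?_
  · have hn : Primrec fun x : α × (β × ℕ) × ℕ => x.2.1 := Primrec.fst.comp Primrec.snd
    exact hR.comp ((Primrec.fst.pair (Primrec.fst.comp hn)).pair
      ((Primrec.snd.comp hn).pair (Primrec.snd.comp Primrec.snd)))
  · simp only [h, Prod.exists]

/-- The witnesses for all `k < f a` are stored in one list, which moves the existential quantifier
to the front. -/
theorem IsSigma2.forall_lt {p : α × ℕ → Prop} (hp : IsSigma2 p) {f : α → ℕ} (hf : Primrec f) :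
    IsSigma2 fun a => ∀ k < f a, p (a, k) := by
  obtain ⟨R, hR, h⟩ := hp
  refine isSigma2_of_primrec (β := List ℕ) (γ := ℕ)
    (R := fun x => ∀ k < f x.1, R ((x.1, k), x.2.1.getD k 0, x.2.2)) ?_ fun a => ?_
  · refine primrecPred_forall_lt (p := fun y : (α × List ℕ × ℕ) × ℕ =>
      R ((y.1.1, y.2), y.1.2.1.getD y.2 0, y.1.2.2)) ?_ (hf.comp Primrec.fst)
    have h2 : Primrec fun y : (α × List ℕ × ℕ) × ℕ => y.1.2 := Primrec.snd.comp Primrec.fst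
    exact hR.comp (((Primrec.fst.comp Primrec.fst).pair Primrec.snd).pair
      (((Primrec.list_getD 0).comp (Primrec.fst.comp h2) Primrec.snd).pair
        (Primrec.snd.comp h2)))
  · simp only [h]
    constructor
    · intro H
      choose! g hg using H
      refine ⟨(List.range (f a)).map g, fun m k hk => ?_⟩
      have : ((List.range (f a)).map g).getD k 0 = g k := by simp [List.getD, hk]
      rw [this]
      exact hg k hk m
    · rintro ⟨l, hl⟩ k hk
      exact ⟨l.getD k 0, fun m => hl m k hk⟩

/-- Where `q` holds the condition is `Π₁`, elsewhere it is `Σ₁`; the decidable case split merges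
both into one matrix. The quantifier that a case does not use needs an inhabitant of `β`. -/
theorem isSigma2_iff_forall {q : α → Prop} {A : α × β → Prop} (hq : PrimrecPred q)
    (hA : PrimrecPred A) : IsSigma2 fun a => q a ↔ ∀ b, A (a, b) := by
  by_cases hβ : Nonempty β
  · refine isSigma2_of_primrec (β := β) (γ := β)
      (R := fun x => (q x.1 ∧ A (x.1, x.2.2)) ∨ (¬ q x.1 ∧ ¬ A (x.1, x.2.1))) ?_ fun a => ?_
    · exact ((hq.comp Primrec.fst).and
        (hA.comp (Primrec.fst.pair (Primrec.snd.comp Primrec.snd)))).or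
        ((hq.comp Primrec.fst).not.and
        (hA.comp (Primrec.fst.pair (Primrec.fst.comp Primrec.snd))).not)
    · by_cases h : q a <;> simp [h]
  · rw [not_nonempty_iff] at hβ
    exact (isSigma2_of_primrecPred hq).of_eq fun a => by simp

end Sigma2

/-! ### Enumerability relative to the halting problem -/

theorem rePred_zeroJump : REPred fun n => n ∈ zeroJump :=
  (Nat.Partrec.Code.eval_part.comp
    ((Computable.ofNat Nat.Partrec.Code).comp (Computable.fst.comp Computable.unpair))
    (Computable.snd.comp Computable.unpair)).dom_re

theorem mem_oracle {A : Set ℕ} {n y : ℕ} :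
    y ∈ oracle A n ↔ (y = 1 ∧ n ∈ A) ∨ (y = 0 ∧ n ∉ A) := by
  by_cases h : n ∈ A <;> simp [oracle, h]

theorem isSigma2_graph_oracle :
    IsSigma2 fun x : ℕ × ℕ => x.2 ∈ oracle zeroJump x.1 := by
  obtain ⟨S, hS, -, h⟩ := exists_primrec_stages rePred_zeroJump
  -- An output below `2` is the oracle's answer iff it is `0` exactly when no stage enumerates the
  -- query.
  have h1 := isSigma2_iff_forall (α := ℕ × ℕ)
    (Primrec.eq.comp Primrec.snd (Primrec.const 0))
    (hS.comp ((Primrec.fst.comp Primrec.fst).pair Primrec.snd)).not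
  refine (h1.and (isSigma2_of_primrecPred
    (Primrec.nat_lt.comp Primrec.snd (Primrec.const 2)))).of_eq fun x => ?_
  simp only [mem_oracle, h, ← not_exists]
  generalize (∃ t, S (x.1, t)) = p
  by_cases hp : p
  · simp only [hp, not_true_eq_false, iff_false, and_true, and_false, or_false]; omega
  · simp only [hp, not_false_eq_true, iff_true, and_true, and_false, false_or]; omega

/-- The graph of a partial function that is recursive in the halting problem is `Σ₂`. -/
theorem isSigma2_graph {f : ℕ →. ℕ} (hf : Nat.RecursiveIn {oracle zeroJump} f) :
    IsSigma2 fun x : ℕ × ℕ => x.2 ∈ f x.1 := by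
  have hx : Primrec (Prod.fst : ℕ × ℕ → ℕ) := Primrec.fst
  have hy : Primrec (Prod.snd : ℕ × ℕ → ℕ) := Primrec.snd
  have of_fun : ∀ {g : ℕ → ℕ}, Primrec g → IsSigma2 fun x : ℕ × ℕ => x.2 = g x.1 := fun hg =>
    isSigma2_of_primrecPred (Primrec.eq.comp hy (hg.comp hx))
  induction hf with
  | zero => exact (of_fun (Primrec.const 0)).of_eq fun x => Part.mem_some_iff.symm
  | succ => exact (of_fun Primrec.succ).of_eq fun x => Part.mem_some_iff.symm
  | left =>
    exact (of_fun (Primrec.fst.comp Primrec.unpair)).of_eq fun x => Part.mem_some_iff.symm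
  | right =>
    exact (of_fun (Primrec.snd.comp Primrec.unpair)).of_eq fun x => Part.mem_some_iff.symm
  | oracle g hg =>
    obtain rfl : g = _ := hg
    exact isSigma2_graph_oracle
  | @pair f h _ _ ihf ihh =>
    have h1 : Primrec fun z : (ℕ × ℕ) × ℕ × ℕ => z.1.1 := Primrec.fst.comp Primrec.fst
    have h2 : Primrec fun z : (ℕ × ℕ) × ℕ × ℕ => z.1.2 := Primrec.snd.comp Primrec.fst
    have h3 : Primrec fun z : (ℕ × ℕ) × ℕ × ℕ => z.2.1 := Primrec.fst.comp Primrec.snd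
    have h4 : Primrec fun z : (ℕ × ℕ) × ℕ × ℕ => z.2.2 := Primrec.snd.comp Primrec.snd
    refine (((ihf.comp (h1.pair h3)).and (ihh.comp (h1.pair h4))).and
      (isSigma2_of_primrecPred
        (Primrec.eq.comp h2 (Primrec₂.natPair.comp h3 h4)))).exists.of_eq fun x => ?_
    simp only [Prod.exists, Seq.seq, Part.map_eq_map, Part.mem_bind_iff, Part.mem_map_iff]
    constructor
    · rintro ⟨u, v, ⟨hu, hv⟩, e⟩
      exact ⟨_, ⟨u, hu, rfl⟩, v, hv, e.symm⟩
    · rintro ⟨_, ⟨u, hu, rfl⟩, v, hv, e⟩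
      exact ⟨u, v, ⟨hu, hv⟩, e.symm⟩
  | @comp f h _ _ ihf ihh =>
    have h1 : Primrec fun z : (ℕ × ℕ) × ℕ => z.1.1 := Primrec.fst.comp Primrec.fst
    have h2 : Primrec fun z : (ℕ × ℕ) × ℕ => z.1.2 := Primrec.snd.comp Primrec.fst
    refine ((ihh.comp (h1.pair Primrec.snd)).and
      (ihf.comp (Primrec.snd.pair h2))).exists.of_eq fun x => ?_
    exact (Part.mem_bind_iff (b := x.2) (f := h x.1) (g := f)).symm
  | @prec f h _ _ ihf ihh =>
    -- The witness is the list of intermediate values of the recursion; `e0`, `e1` and `e2` check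
    -- its start, its steps and the final value.
    have ha : Primrec fun z : (ℕ × ℕ) × List ℕ => z.1.1.unpair.1 :=
      Primrec.fst.comp (Primrec.unpair.comp (Primrec.fst.comp Primrec.fst))
    have hn : Primrec fun z : (ℕ × ℕ) × List ℕ => z.1.1.unpair.2 :=
      Primrec.snd.comp (Primrec.unpair.comp (Primrec.fst.comp Primrec.fst))
    have hl : Primrec fun z : ((ℕ × ℕ) × List ℕ) × ℕ => z.1.2 := Primrec.snd.comp Primrec.fst
    have hk : Primrec fun z : ((ℕ × ℕ) × List ℕ) × ℕ => z.2 := Primrec.snd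
    have e0 := ihf.comp (ha.pair ((Primrec.list_getD 0).comp Primrec.snd (Primrec.const 0)))
    have e1 := (ihh.comp ((Primrec₂.natPair.comp (ha.comp Primrec.fst)
      (Primrec₂.natPair.comp hk ((Primrec.list_getD 0).comp hl hk))).pair
      ((Primrec.list_getD 0).comp hl (Primrec.succ.comp hk)))).forall_lt hn
    have e2 := isSigma2_of_primrecPred (Primrec.eq.comp (Primrec.snd.comp Primrec.fst)
      ((Primrec.list_getD 0).comp Primrec.snd hn))
    refine ((e0.and e1).and e2).exists.of_eq fun x => ?_
    obtain ⟨p, y⟩ := x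
    simp only
    generalize p.unpair.1 = a
    generalize p.unpair.2 = n
    constructor
    · rintro ⟨l, ⟨h0, h1⟩, rfl⟩
      have : ∀ k ≤ n, l.getD k 0 ∈ (Nat.rec (f a) (fun y IH => do
          let i ← IH
          h (Nat.pair a (Nat.pair y i))) k : Part ℕ) := by
        intro k hk
        induction k with
        | zero => exact h0
        | succ k ih => exact Part.mem_bind (ih (by omega)) (h1 k (by omega))
      exact this n le_rfl
    · intro H
      suffices ∃ g : ℕ → ℕ, g 0 ∈ f a ∧
          (∀ k < n, g (k + 1) ∈ h (Nat.pair a (Nat.pair k (g k)))) ∧ y = g n by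
        obtain ⟨g, h0, h1, rfl⟩ := this
        have hg : ∀ k ≤ n, ((List.range (n + 1)).map g).getD k 0 = g k := fun k hk => by
          simp [List.getD, Nat.lt_succ_of_le hk]
        refine ⟨(List.range (n + 1)).map g, ⟨?_, fun k hk => ?_⟩, ?_⟩
        · rwa [hg 0 (Nat.zero_le _)]
        · rw [hg k hk.le, hg (k + 1) hk]
          exact h1 k hk
        · rw [hg n le_rfl]
      induction n generalizing y with
      | zero => exact ⟨fun _ => y, H, by simp, rfl⟩
      | succ n ih =>
        obtain ⟨i, hi, hy⟩ := Part.mem_bind_iff.1 H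
        obtain ⟨g, h0, h1, rfl⟩ := ih i hi
        refine ⟨fun k => if k = n + 1 then y else g k, by simpa using h0, fun k hk => ?_, by simp⟩
        rcases Nat.lt_succ_iff_lt_or_eq.1 hk with hk | rfl
        · have h1' := h1 k hk
          simp only [show k ≠ n by omega, show k ≠ n + 1 by omega, Nat.add_right_cancel_iff,
            if_false]
          exact h1'
        · simpa using hy
  | @rfind f _ ihf =>
    have ha : Primrec fun z : (ℕ × ℕ) × ℕ => z.1.1 := Primrec.fst.comp Primrec.fst
    have e0 := ihf.comp ((Primrec₂.natPair.comp hx hy).pair (Primrec.const 0))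
    have hv : Primrec fun z : ((ℕ × ℕ) × ℕ) × ℕ => z.2 := Primrec.snd
    have e1 := ((ihf.comp ((Primrec₂.natPair.comp (ha.comp Primrec.fst)
      (Primrec.snd.comp Primrec.fst)).pair hv)).and (isSigma2_of_primrecPred
        (Primrec.eq.comp hv (Primrec.const 0)).not)).exists.forall_lt hy
    refine (e0.and e1).of_eq fun x => ?_
    refine Iff.trans ?_ Nat.mem_rfind.symm
    simp only [Part.map_eq_map, Part.mem_map_iff]
    simp

theorem EnumerableIn.isSigma2 {α : Type*} [Primcodable α] {p : α → Prop}
    (h : EnumerableIn zeroJump p) : IsSigma2 p := by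
  refine ((isSigma2_graph h).comp (Primrec.encode.pair (Primrec.const 0))).of_eq fun a => ?_
  simp only [Encodable.encodek, Part.coe_some, Part.bind_some, Part.mem_map_iff,
    Part.mem_assert_iff, Part.mem_some_iff]
  exact ⟨fun ⟨_, ⟨h, _⟩, _⟩ => h, fun h => ⟨(), ⟨h, trivial⟩, rfl⟩⟩

/-- Refutability of a witness `k`, that is `∃ m, ¬ R`, is enumerable, so the oracle decides it, and
a search over `k` halts exactly when some `k` is irrefutable. -/
theorem IsSigma2.enumerableIn {α : Type*} [Primcodable α] {p : α → Prop} (h : IsSigma2 p) :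
    EnumerableIn zeroJump p := by
  obtain ⟨R, hR, h⟩ := h
  -- The negation stands outside, so `Q` holds when decoding fails, and the search does not halt on
  -- such inputs.
  let Q : (ℕ × ℕ) × ℕ → Prop := fun x =>
    ¬ ∃ a ∈ (Encodable.decode x.1.1 : Option α), R (a, x.1.2, x.2)
  have hQ : PrimrecPred Q := by
    refine (primrecPred_exists_mem_option (p := fun y : ((ℕ × ℕ) × ℕ) × α =>
      R (y.2, y.1.1.2, y.1.2)) ?_ (Primrec.decode.comp (Primrec.fst.comp Primrec.fst))).not
    exact hR.comp (Primrec.snd.pair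
      ((Primrec.snd.comp (Primrec.fst.comp Primrec.fst)).pair (Primrec.snd.comp Primrec.fst)))
  obtain ⟨c, hc⟩ := Nat.Partrec.Code.exists_code.1 ((rePred_exists_nat hQ).comp Computable.unpair)
  have hdom : ∀ n k, Nat.pair (Encodable.encode c) (Nat.pair n k) ∈ zeroJump ↔
      ∃ m, Q ((n, k), m) := fun n k => by simp [zeroJump, hc, Part.assert]
  have hq : Nat.RecursiveIn {oracle zeroJump} fun x =>
      oracle zeroJump (Nat.pair (Encodable.encode c) x) := by
    have hp : Primrec fun x : ℕ => Nat.pair (Encodable.encode c) x :=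
      Primrec₂.natPair.comp (Primrec.const _) Primrec.id
    exact ((Nat.RecursiveIn.oracle (O := {oracle zeroJump}) _ rfl).comp
      (Primrec.nat_iff.1 hp).recursiveIn).of_eq fun n => Part.bind_some _ _
  -- The outer zero function replaces the `k` found by `0`, the code of `()`.
  refine (Nat.RecursiveIn.comp Nat.RecursiveIn.zero hq.rfind).of_eq fun n => Part.ext fun y => ?_
  have key : (Nat.rfind fun k => (fun m => decide (m = 0)) <$>
      oracle zeroJump (Nat.pair (Encodable.encode c) (Nat.pair n k))).Dom ↔
      ∃ a ∈ (Encodable.decode n : Option α), p a := by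
    have hmem : ∀ k, true ∈ ((fun m => decide (m = 0)) <$>
        oracle zeroJump (Nat.pair (Encodable.encode c) (Nat.pair n k)) : Part Bool) ↔
        ∀ m, ∃ a ∈ (Encodable.decode n : Option α), R (a, k, m) := by
      intro k
      simp only [Part.map_eq_map, Part.mem_map_iff, mem_oracle, hdom, Q]
      simp
    refine Nat.rfind_dom.trans ?_
    constructor
    · rintro ⟨k, hk, -⟩
      rw [hmem] at hk
      obtain ⟨a, ha, -⟩ := hk 0
      refine ⟨a, ha, (h a).2 ⟨k, fun m => ?_⟩⟩
      obtain ⟨b, hb, hb'⟩ := hk m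
      rwa [Option.mem_unique ha hb]
    · rintro ⟨a, ha, hp⟩
      obtain ⟨k, hk⟩ := (h a).1 hp
      exact ⟨k, (hmem k).2 fun m => ⟨a, ha, hk m⟩, fun _ => trivial⟩
  have hl : y ∈ ((Nat.rfind fun k => (fun m => decide (m = 0)) <$>
      oracle zeroJump (Nat.pair (Encodable.encode c) (Nat.pair n k))) >>= fun _ => 0 : Part ℕ) ↔
      (∃ a ∈ (Encodable.decode n : Option α), p a) ∧ y = 0 := by
    rw [← key, Part.dom_iff_mem]
    refine Part.mem_bind_iff.trans ?_
    exact ⟨fun ⟨k, hk, hy⟩ => ⟨⟨k, hk⟩, Part.mem_some_iff.1 hy⟩,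
      fun ⟨⟨k, hk⟩, hy⟩ => ⟨k, hk, Part.mem_some_iff.2 hy⟩⟩
  refine hl.trans ?_
  simp only [Part.mem_bind_iff, Part.mem_map_iff, Part.mem_assert_iff, Part.mem_some_iff,
    Part.mem_coe]
  constructor
  · rintro ⟨⟨a, ha, hp⟩, rfl⟩
    exact ⟨a, ha, (), ⟨hp, trivial⟩, rfl⟩
  · rintro ⟨a, ha, _, ⟨hp, -⟩, rfl⟩
    exact ⟨⟨a, ha, hp⟩, rfl⟩

/-! ### Strings of a given length -/

/-- The list of all binary strings of length `n`. -/
def strings (n : ℕ) : List (List Bool) :=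
  n.rec [[]] fun _ l => l.map (List.cons false) ++ l.map (List.cons true)

@[simp] theorem strings_zero : strings 0 = [[]] := rfl

theorem strings_succ (n : ℕ) :
    strings (n + 1) = (strings n).map (List.cons false) ++ (strings n).map (List.cons true) := rfl

theorem primrec_strings : Primrec strings := by
  refine Primrec.nat_rec₁ _ (Primrec.list_append.comp ?_ ?_)
  · exact Primrec.list_map Primrec.snd (Primrec.list_cons.comp (Primrec.const false) Primrec.snd)
  · exact Primrec.list_map Primrec.snd (Primrec.list_cons.comp (Primrec.const true) Primrec.snd)

@[simp] theorem length_strings (n : ℕ) : (strings n).length = 2 ^ n := by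
  induction n with
  | zero => rfl
  | succ n ih => simp [strings_succ, ih]; ring

@[simp] theorem mem_strings {n : ℕ} {x : List Bool} : x ∈ strings n ↔ x.length = n := by
  induction n generalizing x with
  | zero => simp
  | succ n ih =>
    cases x with
    | nil => simp [strings_succ]
    | cons b x => cases b <;> simp [strings_succ, ih]

theorem nodup_strings (n : ℕ) : (strings n).Nodup := by
  induction n with
  | zero => simp
  | succ n ih =>
    rw [strings_succ, List.nodup_append]
    refine ⟨ih.map (List.cons_injective), ih.map (List.cons_injective), ?_⟩
    intro a ha b hb
    obtain ⟨u, -, rfl⟩ := List.mem_map.1 ha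
    obtain ⟨v, -, rfl⟩ := List.mem_map.1 hb
    simp

open scoped Classical in
/-- The list of all strings of length `n` with the property `p`. -/
noncomputable def stringsWith (n : ℕ) (p : List Bool → Prop) : List (List Bool) :=
  (strings n).filter fun x => p x

@[simp] theorem mem_stringsWith {n : ℕ} {p : List Bool → Prop} {x : List Bool} :
    x ∈ stringsWith n p ↔ x.length = n ∧ p x := by
  simp [stringsWith]

theorem nodup_stringsWith (n : ℕ) (p : List Bool → Prop) : (stringsWith n p).Nodup :=
  (nodup_strings n).filter _

theorem primrec_stringsWith {α : Type*} [Primcodable α] {p : α × List Bool → Prop} {f : α → ℕ}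
    (hp : PrimrecPred p) (hf : Primrec f) :
    Primrec fun a => stringsWith (f a) fun x => p (a, x) := by
  classical
  have h : PrimrecRel fun (x : List Bool) (a : α) => p (a, x) :=
    hp.comp (Primrec.snd.pair Primrec.fst)
  exact (h.listFilter.comp (primrec_strings.comp hf) Primrec.id).of_eq fun a => by
    simp [stringsWith]

theorem length_stringsWith_le {n : ℕ} {p q : List Bool → Prop}
    (h : ∀ x, x.length = n → p x → q x) :
    (stringsWith n p).length ≤ (stringsWith n q).length := by
  refine ((nodup_stringsWith n p).subperm fun x hx => ?_).length_le
  rw [mem_stringsWith] at *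
  exact ⟨hx.1, h x hx.1 hx.2⟩

/-! ### Initial segments and the uniform measure -/

@[simp] theorem length_initialSegment (ω : ℕ → Bool) (n : ℕ) :
    (initialSegment ω n).length = n := by
  simp [initialSegment]

theorem take_initialSegment (ω : ℕ → Bool) {m n : ℕ} (h : m ≤ n) :
    (initialSegment ω n).take m = initialSegment ω m := by
  simp [initialSegment, ← List.map_take, List.take_range, h]

theorem mem_cylinder {ω : ℕ → Bool} {x : List Bool} :
    ω ∈ cylinder x ↔ initialSegment ω x.length = x := Iff.rfl

instance : IsProbabilityMeasure uniformMeasure := by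
  unfold uniformMeasure; infer_instance

theorem measurable_initialSegment_mem (n : ℕ) (p : List Bool → Prop) :
    MeasurableSet {ω | p (initialSegment ω n)} := by
  let r : (ℕ → Bool) → (Fin n → Bool) := fun ω i => ω i
  have hr : Measurable r := by fun_prop
  have : {ω | p (initialSegment ω n)} = r ⁻¹' {v | p (List.ofFn v)} := by
    ext ω
    have : initialSegment ω n = List.ofFn (r ω) := by
      refine List.ext_getElem (by simp) fun i h1 h2 => ?_
      simp [initialSegment, r]
    simp [this]
  rw [this]
  exact hr (Set.toFinite _).measurableSet

theorem measurableSet_cylinder (x : List Bool) : MeasurableSet (cylinder x) :=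
  measurable_initialSegment_mem x.length fun y => y = x

theorem uniformMeasure_cylinder (x : List Bool) :
    uniformMeasure (cylinder x) = 2⁻¹ ^ x.length := by
  have : cylinder x = Set.pi (Finset.range x.length : Set ℕ) fun i => {x.getD i false} := by
    ext ω
    simp only [mem_cylinder, Set.mem_pi, Finset.coe_range, Set.mem_Iio, Set.mem_singleton_iff]
    constructor
    · intro h i hi
      have h1 : (initialSegment ω x.length)[i]? = x[i]? := by rw [h]
      simp only [initialSegment, List.getElem?_map, List.getElem?_range hi, Option.map_some] at h1
      simp [List.getD, ← h1]
    · intro h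
      refine List.ext_getElem (by simp) fun i h1 h2 => ?_
      simp [initialSegment, h i h2, h2]
  rw [this, uniformMeasure, Measure.infinitePi_pi _ (fun _ _ => MeasurableSet.of_discrete)]
  simp

theorem uniformMeasure_initialSegment_mem (n : ℕ) (p : List Bool → Prop) :
    uniformMeasure {ω | p (initialSegment ω n)} = (stringsWith n p).length * 2⁻¹ ^ n := by
  have h : {ω | p (initialSegment ω n)} = ⋃ x ∈ (stringsWith n p).toFinset, cylinder x := by
    ext ω
    simp only [Set.mem_ofPred_eq, Set.mem_iUnion, List.mem_toFinset, mem_stringsWith, mem_cylinder,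
      exists_prop]
    constructor
    · intro h
      exact ⟨initialSegment ω n, ⟨by simp, h⟩, by simp⟩
    · rintro ⟨x, ⟨rfl, hx⟩, h⟩
      rwa [h]
  rw [h, measure_biUnion_finset]
  · rw [Finset.sum_congr rfl (g := fun _ => 2⁻¹ ^ n)]
    · rw [Finset.sum_const, List.toFinset_card_of_nodup (nodup_stringsWith n p), nsmul_eq_mul]
    · intro x hx
      rw [List.mem_toFinset, mem_stringsWith] at hx
      rw [uniformMeasure_cylinder, hx.1]
  · intro x hx y hy hxy
    simp only [Finset.mem_coe, List.mem_toFinset, mem_stringsWith] at hx hy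
    refine Set.disjoint_left.2 fun ω h1 h2 => hxy ?_
    rw [mem_cylinder] at h1 h2
    rw [← h1, ← h2, hx.1, hy.1]
  · exact fun x _ => measurableSet_cylinder x

/-- Comparison of the measure of a clopen set with a dyadic fraction. -/
theorem uniformMeasure_initialSegment_mem_le {n : ℕ} {p : List Bool → Prop} {a e : ℕ} :
    uniformMeasure {ω | p (initialSegment ω n)} ≤ a * 2⁻¹ ^ e ↔
      (stringsWith n p).length * 2 ^ e ≤ a * 2 ^ n := by
  rw [uniformMeasure_initialSegment_mem, ← ENNReal.inv_pow, ← ENNReal.inv_pow, ← div_eq_mul_inv,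
    ← div_eq_mul_inv, ENNReal.div_le_iff (by simp) (by simp), ENNReal.mul_comm_div,
    ← mul_div_assoc, ENNReal.le_div_iff_mul_le (by simp) (by simp)]
  exact_mod_cast Iff.rfl

/-! ### Prefixes of sequences caught by a test have short descriptions -/

theorem primrec_two_pow {α : Type*} [Primcodable α] {f : α → ℕ} (hf : Primrec f) :
    Primrec fun a => 2 ^ f a :=
  (Primrec₂.unpaired'.1 Nat.Primrec.pow).comp (Primrec.const 2) hf

section Approximation

variable (R : (ℕ × List Bool) × ℕ × ℕ → Prop)

/-- The string `y` lies in one of the first `J` candidate intervals for the `e`-th level of the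
`Σ₂` set with matrix `R`, among those that survive up to stage `i`. -/
def InCandidates (e i J : ℕ) (y : List Bool) : Prop :=
  ∃ j < J, ∃ q ∈ (Encodable.decode j : Option (List Bool × ℕ)),
    y.take q.1.length = q.1 ∧ ∀ m < i, R ((e, q.1), q.2, m)

/-- The number of candidate strings of length `i` is at most `2 ^ (i - e)`. -/
def IsSmall (e i J : ℕ) : Prop :=
  (stringsWith i (InCandidates R e i J)).length * 2 ^ e ≤ 2 ^ i

/-- The union of the candidate sets that are small. -/
def InTrimmed (e i : ℕ) (y : List Bool) : Prop :=
  ∃ J < i + 1, InCandidates R e i J y ∧ IsSmall R e i J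

variable {R}

theorem InCandidates.mono {e i J K : ℕ} {y : List Bool} (h : InCandidates R e i J y)
    (hJK : J ≤ K) : InCandidates R e i K y := by
  obtain ⟨j, hj, hq⟩ := h
  exact ⟨j, hj.trans_le hJK, hq⟩

/-- Candidate sets grow with `J`, so the union of the small ones is the largest small one. -/
theorem length_stringsWith_inTrimmed (e i : ℕ) :
    (stringsWith i (InTrimmed R e i)).length * 2 ^ e ≤ 2 ^ i := by
  suffices ∀ K, (stringsWith i fun y => ∃ J < K, InCandidates R e i J y ∧
      IsSmall R e i J).length * 2 ^ e ≤ 2 ^ i from this (i + 1)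
  intro K
  induction K with
  | zero => simp [stringsWith]
  | succ K ih =>
    by_cases hK : IsSmall R e i K
    · refine le_trans (Nat.mul_le_mul_right _ (length_stringsWith_le ?_)) hK
      rintro y - ⟨J, hJ, hy, -⟩
      exact hy.mono (Nat.lt_succ_iff.1 hJ)
    · refine le_trans (Nat.mul_le_mul_right _ (length_stringsWith_le ?_)) ih
      rintro y - ⟨J, hJ, hy, hs⟩
      rcases Nat.lt_succ_iff_lt_or_eq.1 hJ with h | rfl
      · exact ⟨J, h, hy, hs⟩
      · exact absurd hs hK

theorem primrecPred_inCandidates (hR : PrimrecPred R) :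
    PrimrecPred fun x : (ℕ × ℕ × ℕ) × List Bool => InCandidates R x.1.1 x.1.2.1 x.1.2.2 x.2 := by
  refine primrecPred_exists_lt (p := fun z : ((ℕ × ℕ × ℕ) × List Bool) × ℕ =>
    ∃ q ∈ (Encodable.decode z.2 : Option (List Bool × ℕ)),
      z.1.2.take q.1.length = q.1 ∧ ∀ m < z.1.1.2.1, R ((z.1.1.1, q.1), q.2, m)) ?_
    (Primrec.snd.comp (Primrec.snd.comp Primrec.fst))
  refine primrecPred_exists_mem_option
    (p := fun w : (((ℕ × ℕ × ℕ) × List Bool) × ℕ) × List Bool × ℕ =>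
      w.1.1.2.take w.2.1.length = w.2.1 ∧ ∀ m < w.1.1.1.2.1, R ((w.1.1.1.1, w.2.1), w.2.2, m)) ?_
    (Primrec.decode.comp Primrec.snd)
  have hx : Primrec fun w : (((ℕ × ℕ × ℕ) × List Bool) × ℕ) × List Bool × ℕ => w.1.1 :=
    Primrec.fst.comp Primrec.fst
  have hq : Primrec fun w : (((ℕ × ℕ × ℕ) × List Bool) × ℕ) × List Bool × ℕ => w.2.1 :=
    Primrec.fst.comp Primrec.snd
  refine (Primrec.eq.comp (Primrec.list_take.comp (Primrec.list_length.comp hq)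
    (Primrec.snd.comp hx)) hq).and ?_
  refine primrecPred_forall_lt
    (p := fun v : ((((ℕ × ℕ × ℕ) × List Bool) × ℕ) × List Bool × ℕ) × ℕ =>
      R ((v.1.1.1.1.1, v.1.2.1), v.1.2.2, v.2)) ?_
    (Primrec.fst.comp (Primrec.snd.comp (Primrec.fst.comp hx)))
  exact hR.comp ((((Primrec.fst.comp (Primrec.fst.comp hx)).comp Primrec.fst).pair
    (hq.comp Primrec.fst)).pair ((Primrec.snd.comp (Primrec.snd.comp Primrec.fst)).pair
      Primrec.snd))

theorem primrecPred_inTrimmed (hR : PrimrecPred R) :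
    PrimrecPred fun x : (ℕ × ℕ) × List Bool => InTrimmed R x.1.1 x.1.2 x.2 := by
  have he : Primrec fun z : ((ℕ × ℕ) × List Bool) × ℕ => z.1.1.1 :=
    Primrec.fst.comp (Primrec.fst.comp Primrec.fst)
  have hi : Primrec fun z : ((ℕ × ℕ) × List Bool) × ℕ => z.1.1.2 :=
    Primrec.snd.comp (Primrec.fst.comp Primrec.fst)
  refine primrecPred_exists_lt (p := fun z : ((ℕ × ℕ) × List Bool) × ℕ =>
    InCandidates R z.1.1.1 z.1.1.2 z.2 z.1.2 ∧ IsSmall R z.1.1.1 z.1.1.2 z.2) ?_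
    (Primrec.succ.comp (Primrec.snd.comp Primrec.fst))
  refine ((primrecPred_inCandidates hR).comp ((he.pair (hi.pair Primrec.snd)).pair
    (Primrec.snd.comp Primrec.fst))).and ?_
  refine Primrec.nat_le.comp (Primrec.nat_mul.comp (Primrec.list_length.comp ?_)
    (primrec_two_pow he)) (primrec_two_pow hi)
  refine primrec_stringsWith (p := fun w : (((ℕ × ℕ) × List Bool) × ℕ) × List Bool =>
    InCandidates R w.1.1.1.1 w.1.1.1.2 w.1.2 w.2) ?_ hi
  exact (primrecPred_inCandidates hR).comp (((he.comp Primrec.fst).pair ((hi.comp Primrec.fst).pair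
    (Primrec.snd.comp Primrec.fst))).pair Primrec.snd)

variable (R) in
/-- The description method in which `1ᵉ 0 q` describes a string in the trimmed approximation of
level `2 * e` and length `|q| + 2 * e`, namely the one whose position is that of `q` among the
strings of length `|q|`. -/
noncomputable def trimmedMethod (p : List Bool) : Option (List Bool) :=
  (stringsWith ((p.drop (p.idxOf false + 1)).length + 2 * p.idxOf false)
    (InTrimmed R (2 * p.idxOf false)
      ((p.drop (p.idxOf false + 1)).length + 2 * p.idxOf false)))[
    (strings (p.drop (p.idxOf false + 1)).length).idxOf (p.drop (p.idxOf false + 1))]?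

theorem primrec_trimmedMethod (hR : PrimrecPred R) : Primrec (trimmedMethod R) := by
  have he : Primrec fun p : List Bool => p.idxOf false :=
    Primrec.list_idxOf.comp (Primrec.const false) Primrec.id
  have hq : Primrec fun p : List Bool => p.drop (p.idxOf false + 1) :=
    Primrec.list_drop.comp (Primrec.succ.comp he) Primrec.id
  have hl := Primrec.list_length.comp hq
  have h2 : Primrec fun p : List Bool => 2 * p.idxOf false := Primrec.nat_double.comp he
  have hi := Primrec.nat_add.comp hl h2
  have hpos : Primrec fun p : List Bool => (strings (p.drop (p.idxOf false + 1)).length).idxOf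
      (p.drop (p.idxOf false + 1)) := by
    convert Primrec.list_idxOf.comp hq (primrec_strings.comp hl)
  refine Primrec.list_getElem?.comp (primrec_stringsWith (p := fun z : List Bool × List Bool =>
    InTrimmed R (2 * z.1.idxOf false)
      ((z.1.drop (z.1.idxOf false + 1)).length + 2 * z.1.idxOf false) z.2) ?_ hi)
    hpos
  exact (primrecPred_inTrimmed hR).comp (((h2.comp Primrec.fst).pair (hi.comp Primrec.fst)).pair
    Primrec.snd)

/-- Level `2 * e` leaves so few strings that a position fits in `i - 2 * e` bits. The prefix `1ᵉ 0`
gives back only `e + 1` of the `2 * e` bits saved. -/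
theorem exists_description_of_inTrimmed {e i : ℕ} {y : List Bool} (hi : 2 * e ≤ i)
    (hy : y.length = i) (h : InTrimmed R (2 * e) i y) :
    ∃ p : List Bool, trimmedMethod R p = some y ∧ p.length + e = i + 1 := by
  obtain ⟨l, rfl⟩ := Nat.exists_eq_add_of_le' hi
  obtain ⟨r, hr, hry⟩ := List.mem_iff_getElem.1 (mem_stringsWith.2 ⟨hy, h⟩)
  have hr' : r < (strings l).length := by
    have := length_stringsWith_inTrimmed (R := R) (2 * e) (l + 2 * e)
    rw [pow_add] at this
    rw [length_strings]
    exact hr.trans_le (Nat.le_of_mul_le_mul_right this (by positivity))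
  have hq : (strings l)[r].length = l := mem_strings.1 (List.getElem_mem hr')
  refine ⟨List.replicate e true ++ false :: (strings l)[r], ?_, by simp [hq]; ring⟩
  have hidx : (List.replicate e true ++ false :: (strings l)[r]).idxOf false = e := by
    rw [List.idxOf_append_of_notMem (by simp)]; simp
  have hdrop : (List.replicate e true ++ false :: (strings l)[r]).drop (e + 1)
      = (strings l)[r] := by
    simp [List.drop_append]
  rw [trimmedMethod, hidx, hdrop, hq, (nodup_strings l).idxOf_getElem, ← hry]
  exact List.getElem?_eq_getElem hr

end Approximation

theorem complexity_le {D : List Bool →. List Bool} {p x : List Bool} (h : x ∈ D p) :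
    complexity D x ≤ p.length :=
  iInf₂_le p h

/-- Every interval of a `Σ₂` open set of measure at most `2⁻ᵉ` belongs to almost all trimmed
approximations. -/
theorem exists_forall_inTrimmed {R : (ℕ × List Bool) × ℕ × ℕ → Prop} {U : Set (ℕ × List Bool)}
    (hU : ∀ a, a ∈ U ↔ ∃ n, ∀ m, R (a, n, m)) {e : ℕ}
    (hμ : uniformMeasure (openSection U e) ≤ 2⁻¹ ^ e) {ω : ℕ → Bool}
    (hω : ω ∈ openSection U e) :
    ∃ N, ∀ i ≥ N, InTrimmed R e i (initialSegment ω i) := by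
  simp only [openSection, Set.mem_iUnion, Set.mem_ofPred_eq, exists_prop] at hω
  obtain ⟨x, hxU, hx⟩ := hω
  obtain ⟨n, hn⟩ := (hU _).1 hxU
  set J := Encodable.encode (x, n) + 1 with hJ
  -- Each of the finitely many false candidates is refuted by some `m`; beyond all these `m` only
  -- true ones survive.
  have hkill : ∀ K, ∃ N, ∀ i ≥ N, ∀ j < K, ∀ q ∈ (Encodable.decode j : Option (List Bool × ℕ)),
      (∀ m < i, R ((e, q.1), q.2, m)) → (e, q.1) ∈ U := by
    intro K
    induction K with
    | zero => exact ⟨0, by simp⟩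
    | succ K ih =>
      obtain ⟨N, hN⟩ := ih
      obtain ⟨M, hM⟩ : ∃ M, ∀ i ≥ M, ∀ q ∈ (Encodable.decode K : Option (List Bool × ℕ)),
          (∀ m < i, R ((e, q.1), q.2, m)) → (e, q.1) ∈ U := by
        cases hd : (Encodable.decode K : Option (List Bool × ℕ)) with
        | none => exact ⟨0, by simp⟩
        | some q =>
          by_cases hq : ∀ m, R ((e, q.1), q.2, m)
          · refine ⟨0, fun i _ q' hq' _ => ?_⟩
            obtain rfl : q = q' := by simpa using hq'
            exact (hU _).2 ⟨_, hq⟩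
          · push Not at hq
            obtain ⟨m, hm⟩ := hq
            refine ⟨m + 1, fun i hi q' hq' h => ?_⟩
            obtain rfl : q = q' := by simpa using hq'
            exact absurd (h m (by omega)) hm
      refine ⟨max N M, fun i hi j hj => ?_⟩
      rcases Nat.lt_succ_iff_lt_or_eq.1 hj with h | rfl
      · exact hN i (le_of_max_le_left hi) j h
      · exact hM i (le_of_max_le_right hi)
  obtain ⟨N, hN⟩ := hkill J
  refine ⟨max N (max J x.length), fun i hi => ⟨J, ?_, ?_, ?_⟩⟩
  · have := le_of_max_le_left (le_of_max_le_right hi)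
    omega
  · refine ⟨_, Nat.lt_succ_self _, (x, n), by simp, ?_, fun m _ => hn m⟩
    rw [take_initialSegment ω (le_of_max_le_right (le_of_max_le_right hi))]
    exact hx
  · have hsub : {ω | InCandidates R e i J (initialSegment ω i)} ⊆ openSection U e := by
      rintro ω' ⟨j, hj, q, hq, htake, hR⟩
      simp only [openSection, Set.mem_iUnion, Set.mem_ofPred_eq, exists_prop]
      refine ⟨q.1, hN i (le_of_max_le_left hi) j hj q hq hR, ?_⟩
      have hlen : q.1.length ≤ i := by
        have := congrArg List.length htake
        simp only [List.length_take, length_initialSegment] at this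
        omega
      rw [take_initialSegment ω' hlen] at htake
      exact htake
    have h := (measure_mono hsub).trans hμ
    have := (uniformMeasure_initialSegment_mem_le (a := 1) (e := e)).1 (by simpa using h)
    simpa [IsSmall] using this

theorem isMartinLofRandomIn_of_infinite {D : List Bool →. List Bool} (hD : IsOptimal D)
    {ω : ℕ → Bool} {c : ℕ}
    (h : {n : ℕ | (n : ℕ∞) ≤ complexity D (initialSegment ω n) + c}.Infinite) :
    IsMartinLofRandomIn zeroJump ω := by
  rintro U ⟨hU, hμ⟩ hω
  obtain ⟨R, hR, hRU⟩ := hU.isSigma2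
  obtain ⟨c', hc'⟩ := hD.2 (fun p => (trimmedMethod R p : Part (List Bool)))
    (primrec_trimmedMethod hR).to_comp.ofOption
  -- The description has length `n + 1 - e`; adding `c' + c` gives `n - 1`, below the assumed `n`.
  set e := c + c' + 2 with he
  obtain ⟨N, hN⟩ := exists_forall_inTrimmed hRU (hμ (2 * e)) (Set.mem_iInter.1 hω (2 * e))
  obtain ⟨n, hn, hlt⟩ := h.exists_gt (max N (2 * e))
  have hNn : N ≤ n := (le_max_left _ _).trans hlt.le
  have hen : 2 * e ≤ n := (le_max_right _ _).trans hlt.le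
  obtain ⟨p, hp, hlen⟩ := exists_description_of_inTrimmed hen (by simp) (hN n hNn)
  have h1 := (hc' (initialSegment ω n)).trans
    (add_le_add_left (complexity_le (p := p) (by simp [hp])) _)
  have h2 : (n : ℕ∞) ≤ p.length + c' + c := le_trans hn (add_le_add_left h1 _)
  have h3 : n ≤ p.length + c' + c := by exact_mod_cast h2
  omega

/-! ### Strings of small complexity -/

theorem complexity_add_lt_iff {D : List Bool →. List Bool} {x : List Bool} {k n : ℕ} :
    complexity D x + k < n ↔ ∃ p, x ∈ D p ∧ p.length + k < n := by
  constructor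
  · intro h
    have hfin : complexity D x ≠ ⊤ := by
      rintro e
      simp [e] at h
    -- A description of length below `complexity D x + 1` attains the infimum.
    have hlt : complexity D x < complexity D x + 1 := (ENat.lt_add_one_iff hfin).2 le_rfl
    conv_lhs at hlt => rw [complexity]
    simp only [iInf_lt_iff, Set.mem_ofPred_eq, exists_prop] at hlt
    obtain ⟨p, hp, hlen⟩ := hlt
    refine ⟨p, hp, ?_⟩
    have h1 : (p.length : ℕ∞) ≤ complexity D x := (ENat.lt_add_one_iff hfin).1 hlen
    exact_mod_cast (add_le_add_left h1 (k : ℕ∞)).trans_lt h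
  · rintro ⟨p, hp, hlt⟩
    refine (add_le_add_left (complexity_le hp) _).trans_lt ?_
    exact_mod_cast hlt

theorem rePred_complexity_add_lt {D : List Bool →. List Bool} (hD : Partrec D) :
    REPred fun x : ℕ × List Bool => complexity D x.2 + (x.1 + 1 : ℕ) < x.2.length := by
  have hopt : Primrec fun z : ((ℕ × List Bool) × List Bool) × List Bool =>
      if z.2 = z.1.1.2 ∧ z.1.2.length + (z.1.1.1 + 1) < z.1.1.2.length then some () else none := by
    have hx : Primrec fun z : ((ℕ × List Bool) × List Bool) × List Bool => z.1.1.2 :=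
      Primrec.snd.comp (Primrec.fst.comp Primrec.fst)
    have hc : Primrec fun z : ((ℕ × List Bool) × List Bool) × List Bool => z.1.1.1 :=
      Primrec.fst.comp (Primrec.fst.comp Primrec.fst)
    exact Primrec.ite ((Primrec.eq.comp Primrec.snd hx).and (Primrec.nat_lt.comp
      (Primrec.nat_add.comp (Primrec.list_length.comp (Primrec.snd.comp Primrec.fst))
        (Primrec.succ.comp hc)) (Primrec.list_length.comp hx)))
      (Primrec.const (some ())) (Primrec.const none)
  have h := ((hD.comp (Computable.snd (α := ℕ × List Bool))).bind
    hopt.to_comp.ofOption.to₂).dom_re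
  refine (rePred_exists h).of_eq fun x => ?_
  rw [complexity_add_lt_iff]
  refine exists_congr fun p => ?_
  simp only [Part.dom_iff_mem, Part.mem_bind_iff]
  constructor
  · rintro ⟨u, y, hy, hu⟩
    split_ifs at hu with hif
    · exact ⟨hif.1 ▸ hy, hif.2⟩
    · simp at hu
  · rintro ⟨hp, hlen⟩
    exact ⟨(), x.2, hp, by simp [hlen]⟩

/-- Distinct strings have distinct descriptions, and at most `2 ^ (n - k)` descriptions are shorter
than `n - k`. -/
theorem length_stringsWith_complexity_add_lt (D : List Bool →. List Bool) (k n : ℕ) :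
    (stringsWith n fun x => complexity D x + k < n).length * 2 ^ k ≤ 2 ^ n := by
  classical
  choose! d hd using fun x (h : complexity D x + k < n) => complexity_add_lt_iff.1 h
  set L := stringsWith n fun x => complexity D x + k < n with hL
  have hmem : ∀ x ∈ L, x ∈ D (d x) ∧ (d x).length + k < n := fun x hx =>
    hd x (mem_stringsWith.1 hx).2
  have hcard : L.toFinset.card ≤
      ((Finset.range (n - k)).biUnion fun l => (strings l).toFinset).card := by
    refine Finset.card_le_card_of_injOn d (fun x hx => ?_) fun x hx y hy hxy => ?_
    · have := (hmem x (by simpa using hx)).2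
      simp only [Finset.coe_biUnion, Set.mem_iUnion, Finset.mem_coe, Finset.mem_range,
        List.mem_toFinset, mem_strings, exists_prop]
      exact ⟨_, by omega, rfl⟩
    · have h1 := (hmem x (by simpa using hx)).1
      have h2 := (hmem y (by simpa using hy)).1
      rw [hxy] at h1
      exact Part.mem_unique h1 h2
  rw [List.toFinset_card_of_nodup (nodup_stringsWith _ _)] at hcard
  have hsum : ∀ m, ∑ l ∈ Finset.range m, 2 ^ l ≤ 2 ^ m := by
    intro m
    induction m with
    | zero => simp
    | succ m ih => rw [Finset.sum_range_succ, pow_succ]; omega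
  have hle : L.length ≤ 2 ^ (n - k) := by
    refine hcard.trans (Finset.card_biUnion_le.trans (le_trans ?_ (hsum _)))
    refine Finset.sum_le_sum fun l _ => ?_
    rw [List.toFinset_card_of_nodup (nodup_strings l), length_strings]
  rcases le_total k n with h | h
  · calc L.length * 2 ^ k ≤ 2 ^ (n - k) * 2 ^ k := Nat.mul_le_mul_right _ hle
      _ = 2 ^ n := by rw [← pow_add, Nat.sub_add_cancel h]
  · have : L = [] := List.eq_nil_iff_forall_not_mem.2 fun x hx => by
      have := (hmem x hx).2
      omega
    simp [this]

theorem uniformMeasure_complexity_add_lt (D : List Bool →. List Bool) (k n : ℕ) :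
    uniformMeasure {ω | complexity D (initialSegment ω n) + k < (initialSegment ω n).length} ≤
      2⁻¹ ^ k := by
  simp only [length_initialSegment]
  have := (uniformMeasure_initialSegment_mem_le (n := n) (p := fun x => complexity D x + k < n)
    (a := 1) (e := k)).2 (by simpa using length_stringsWith_complexity_add_lt D k n)
  simpa using this

/-! ### Covering a lower limit of open sets by an open set enumerable in the halting problem

The sets `V₀, V₁, …` are processed in stages. A history is the list of the decisions of all past
stages, the latest first; at stage `M` with `k` positive decisions so far, a positive decision
puts the intersection of all `Vₙ` with `k ≤ n ≤ M` into the cover. -/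

section Covered

/-- A point with `P n ↔ · ∈ Vₙ` lies in the cover after the history `b`. -/
def Covered (P : ℕ → Prop) (b : List Bool) : Prop :=
  ∃ j < b.length, b.getD j false = true ∧
    ∀ n < b.length - j, (b.drop (j + 1)).count true ≤ n → P n

theorem covered_cons {P : ℕ → Prop} {a : Bool} {l : List Bool} :
    Covered P (a :: l) ↔
      (a = true ∧ ∀ n < l.length + 1, l.count true ≤ n → P n) ∨ Covered P l := by
  constructor
  · rintro ⟨j, hj, ha, h⟩
    cases j with
    | zero => exact Or.inl ⟨by simpa using ha, by simpa using h⟩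
    | succ j => exact Or.inr ⟨j, by simpa using hj, by simpa using ha, by simpa using h⟩
  · rintro (⟨ha, h⟩ | ⟨j, hj, ha, h⟩)
    · exact ⟨0, by simp, by simpa using ha, by simpa using h⟩
    · exact ⟨j + 1, by simpa using hj, by simpa using ha, by simpa using h⟩

theorem not_covered_nil {P : ℕ → Prop} : ¬ Covered P [] := by
  rintro ⟨j, hj, -⟩
  simp at hj

theorem Covered.mono {P Q : ℕ → Prop} {b : List Bool} (h : Covered P b)
    (hPQ : ∀ n < b.length, P n → Q n) : Covered Q b := by
  obtain ⟨j, hj, hb, h⟩ := h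
  exact ⟨j, hj, hb, fun n hn hc => hPQ n (by omega) (h n hn hc)⟩

theorem covered_congr {P Q : ℕ → Prop} {b : List Bool} (h : ∀ n < b.length, P n ↔ Q n) :
    Covered P b ↔ Covered Q b :=
  ⟨fun H => H.mono fun n hn => (h n hn).1, fun H => H.mono fun n hn => (h n hn).2⟩

/-- Only finitely many `n` matter, so one late stage serves them all. -/
theorem covered_exists_iff {S : ℕ → ℕ → Prop} (hS : ∀ n s t, s ≤ t → S n s → S n t)
    {b : List Bool} : Covered (fun n => ∃ t, S n t) b ↔ ∃ t, Covered (fun n => S n t) b := by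
  constructor
  · rintro ⟨j, hj, hb, h⟩
    choose! T hT using h
    refine ⟨(Finset.range (b.length - j)).sup T, j, hj, hb, fun n hn hc => ?_⟩
    exact hS n _ _ (Finset.le_sup (f := T) (Finset.mem_range.2 hn)) (hT n hn hc)
  · rintro ⟨t, h⟩
    exact h.mono fun n _ hn => ⟨t, hn⟩

/-- The positive decision made after exactly `N` earlier ones involves only indices `n ≥ N`. -/
theorem covered_of_lt_count {P : ℕ → Prop} {N : ℕ} (hP : ∀ n ≥ N, P n) {b : List Bool}
    (hb : N < b.count true) : Covered P b := by
  induction b with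
  | nil => simp at hb
  | cons a l ih =>
    rw [covered_cons]
    by_cases h : N < l.count true
    · exact Or.inr (ih h)
    · cases a with
      | false => simp at hb; omega
      | true =>
        simp only [List.count_cons_self] at hb
        exact Or.inl ⟨rfl, fun n _ hn => hP n (by omega)⟩

theorem primrec_count_true : Primrec fun l : List Bool => l.count true := by
  have h : Primrec fun l : List Bool => (l.filter fun b => decide (b = true)).length :=
    Primrec.list_length.comp
      (Primrec.listFilter (Primrec.eq.comp Primrec.id (Primrec.const true)))
  refine h.of_eq fun l => ?_
  rw [List.count_eq_length_filter]
  congr 2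

theorem primrecPred_covered {α : Type*} [Primcodable α] {p : α × ℕ → Prop} (hp : PrimrecPred p)
    {f : α → List Bool} (hf : Primrec f) :
    PrimrecPred fun a => Covered (fun n => p (a, n)) (f a) := by
  have hb : Primrec fun x : α × ℕ => f x.1 := hf.comp Primrec.fst
  refine primrecPred_exists_lt (p := fun x : α × ℕ => (f x.1).getD x.2 false = true ∧
    ∀ n < (f x.1).length - x.2, ((f x.1).drop (x.2 + 1)).count true ≤ n → p (x.1, n)) ?_
    (Primrec.list_length.comp hf)
  refine (Primrec.eq.comp ((Primrec.list_getD false).comp hb Primrec.snd)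
    (Primrec.const true)).and ?_
  refine primrecPred_forall_lt (p := fun y : (α × ℕ) × ℕ =>
    ((f y.1.1).drop (y.1.2 + 1)).count true ≤ y.2 → p (y.1.1, y.2)) ?_
    (Primrec.nat_sub.comp (Primrec.list_length.comp hb) Primrec.snd)
  have h1 : PrimrecPred fun y : (α × ℕ) × ℕ =>
      ((f y.1.1).drop (y.1.2 + 1)).count true ≤ y.2 :=
    Primrec.nat_le.comp (primrec_count_true.comp (Primrec.list_drop.comp
      (Primrec.succ.comp (Primrec.snd.comp Primrec.fst)) (hb.comp Primrec.fst))) Primrec.snd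
  exact (h1.not.or (hp.comp ((Primrec.fst.comp Primrec.fst).pair Primrec.snd))).of_eq
    fun y => imp_iff_not_or.symm

end Covered

/-- The budget `2⁻ᶜ - 2⁻⁽ᶜ⁺¹⁺ᵏ⁾` for the measure of the cover after `k` positive decisions. -/
noncomputable def budget (c k : ℕ) : ENNReal :=
  (2 ^ (k + 1) - 1 : ℕ) * 2⁻¹ ^ (c + 1 + k)

theorem budget_zero (c : ℕ) : budget c 0 = 2⁻¹ ^ (c + 1) := by simp [budget]

theorem budget_succ (c k : ℕ) : budget c (k + 1) = budget c k + 2⁻¹ ^ (c + 1 + k + 1) := by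
  have h : 2 ^ (k + 1 + 1) - 1 = (2 ^ (k + 1) - 1) * 2 + 1 := by
    have : 0 < 2 ^ (k + 1) := by positivity
    rw [pow_succ 2 (k + 1)]; omega
  rw [budget, budget, h, Nat.cast_add, Nat.cast_mul, add_mul, Nat.cast_one, one_mul, ← add_assoc]
  congr 1
  rw [pow_succ _ (c + 1 + k), mul_assoc, mul_comm (2⁻¹ ^ _ : ENNReal),
    ← mul_assoc ((2 : ℕ) : ENNReal), Nat.cast_ofNat, ENNReal.mul_inv_cancel (by simp) (by simp), one_mul]

theorem budget_le (c k : ℕ) : budget c k ≤ 2⁻¹ ^ c := by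
  have h : ((2 ^ (k + 1) - 1 : ℕ) : ENNReal) ≤ 2 ^ (k + 1) := by
    exact_mod_cast Nat.sub_le _ _
  calc budget c k ≤ 2 ^ (k + 1) * 2⁻¹ ^ (c + 1 + k) := by
        unfold budget; gcongr
    _ = (2 * 2⁻¹) ^ (k + 1) * 2⁻¹ ^ c := by
        rw [mul_pow, mul_assoc, ← pow_add]; congr 2; ring
    _ = 2⁻¹ ^ c := by rw [ENNReal.mul_inv_cancel (by simp) (by simp), one_pow, one_mul]

/-! ### Measure of the cover -/

section Cover

variable (P : ℕ × List Bool → Prop) (c : ℕ)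

/-- The `n`-th open set of level `c`. -/
def levelSet (n : ℕ) : Set (ℕ → Bool) := {ω | P (c, initialSegment ω n)}

/-- The cover after the history `b`. -/
def coverSet (b : List Bool) : Set (ℕ → Bool) :=
  {ω | Covered (fun n => P (c, initialSegment ω n)) b}

/-- A positive decision after the history `l` does not exceed the budget. -/
def IsAffordable (l : List Bool) : Prop :=
  ∀ i ≥ l.length,
    uniformMeasure (coverSet P c (true :: l) ∪ levelSet P c i) ≤ budget c (l.count true + 1)

open scoped Classical in
/-- The history up to stage `M`, when a decision is positive if and only if it is affordable. -/
noncomputable def history : ℕ → List Bool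
  | 0 => []
  | M + 1 => decide (IsAffordable P c (history M)) :: history M

variable {P c}

@[simp] theorem length_history (M : ℕ) : (history P c M).length = M := by
  induction M with
  | zero => rfl
  | succ M ih => simp [history, ih]

theorem measurableSet_levelSet (n : ℕ) : MeasurableSet (levelSet P c n) :=
  measurable_initialSegment_mem n fun x => P (c, x)

theorem coverSet_nil : coverSet P c [] = ∅ := by
  ext ω
  simp [coverSet, not_covered_nil]

theorem coverSet_false_cons (l : List Bool) : coverSet P c (false :: l) = coverSet P c l := by
  ext ω
  simp [coverSet, covered_cons]

theorem coverSet_true_cons (l : List Bool) : coverSet P c (true :: l) =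
    {ω | ∀ n < l.length + 1, l.count true ≤ n → ω ∈ levelSet P c n} ∪ coverSet P c l := by
  ext ω
  simp [coverSet, covered_cons, levelSet]

theorem history_succ_of_isAffordable {M : ℕ} (h : IsAffordable P c (history P c M)) :
    history P c (M + 1) = true :: history P c M := by
  simp [history, h]

theorem history_succ_of_not_isAffordable {M : ℕ} (h : ¬ IsAffordable P c (history P c M)) :
    history P c (M + 1) = false :: history P c M := by
  simp [history, h]

theorem coverSet_history_mono : Monotone fun M => coverSet P c (history P c M) := by
  refine monotone_nat_of_le_succ fun M ω h => ?_
  exact covered_cons.2 (Or.inr h)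

theorem count_history_mono : Monotone fun M => (history P c M).count true :=
  monotone_nat_of_le_succ fun M => by simp only [history]; exact List.count_le_count_cons

/-- Including every later `levelSet P c i` in the bound is what keeps further positive decisions
cheap. -/
theorem uniformMeasure_coverSet_history_union_le
    (hP : ∀ n, uniformMeasure (levelSet P c n) ≤ 2⁻¹ ^ (c + 1)) (M : ℕ) : ∀ i ≥ M,
    uniformMeasure (coverSet P c (history P c M) ∪ levelSet P c i) ≤
      budget c ((history P c M).count true) := by
  induction M with
  | zero =>
    intro i _
    simpa [history, coverSet_nil, budget_zero] using hP i
  | succ M ih =>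
    intro i hi
    by_cases h : IsAffordable P c (history P c M)
    · rw [history_succ_of_isAffordable h, List.count_cons_self]
      exact h i (by simp; omega)
    · rw [history_succ_of_not_isAffordable h, coverSet_false_cons]
      simpa using ih i (by omega)

/-- If all decisions from `M₀` on were negative, the count would freeze at `k`. The finite
intersections `A M` decrease to a set contained in each `levelSet P c i` with `i ≥ k`, which the
invariant has already paid for. Only `A M \ ⋂ M, A M` is new, and its measure drops below the next
increment of the budget. -/
theorem exists_isAffordable
    (hP : ∀ n, uniformMeasure (levelSet P c n) ≤ 2⁻¹ ^ (c + 1)) (M₀ : ℕ) :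
    ∃ M ≥ M₀, IsAffordable P c (history P c M) := by
  by_contra! hno
  set k := (history P c M₀).count true with hk
  have hcount : ∀ M ≥ M₀, (history P c M).count true = k := by
    intro M hM
    induction M, hM using Nat.le_induction with
    | base => rfl
    | succ M hM ih =>
      rw [history_succ_of_not_isAffordable (hno M hM)]
      simpa using ih
  have hkM : ∀ M ≥ M₀, k ≤ M := fun M hM =>
    (hcount M hM) ▸ (List.count_le_length.trans (length_history M).le)
  let A : ℕ → Set (ℕ → Bool) := fun M => {ω | ∀ n < M + 1, k ≤ n → ω ∈ levelSet P c n}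
  have hA : ∀ M, MeasurableSet (A M) := by
    intro M
    have : A M = ⋂ n, ⋂ (_ : n < M + 1), ⋂ (_ : k ≤ n), levelSet P c n := by
      ext ω; simp [A]
    rw [this]
    exact .iInter fun n => .iInter fun _ => .iInter fun _ => measurableSet_levelSet n
  have hanti : Antitone A := fun M M' h ω hω n hn => hω n (by omega)
  have hinf : MeasurableSet (⋂ M, A M) := .iInter hA
  have hlim := tendsto_measure_iInter_atTop (μ := uniformMeasure)
    (fun M => (hA M).nullMeasurableSet) hanti ⟨0, measure_ne_top _ _⟩
  have hlt : uniformMeasure (⋂ M, A M) <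
      uniformMeasure (⋂ M, A M) + 2⁻¹ ^ (c + 1 + k + 1) :=
    ENNReal.lt_add_right (measure_ne_top _ _) (by simp)
  obtain ⟨M, hMlt, hM⟩ := ((hlim.eventually_lt_const hlt).and
    (Filter.eventually_ge_atTop M₀)).exists
  refine hno M hM fun i hi => ?_
  rw [length_history] at hi
  have hdiff : uniformMeasure (A M \ ⋂ M, A M) ≤ 2⁻¹ ^ (c + 1 + k + 1) := by
    rw [measure_sdiff (Set.iInter_subset _ _) hinf.nullMeasurableSet (measure_ne_top _ _)]
    exact tsub_le_iff_left.2 hMlt.le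
  have hsub : coverSet P c (true :: history P c M) ∪ levelSet P c i ⊆
      (coverSet P c (history P c M) ∪ levelSet P c i) ∪ (A M \ ⋂ M, A M) := by
    rw [coverSet_true_cons, length_history, hcount M hM]
    rintro ω ((h | h) | h)
    · by_cases h' : ω ∈ ⋂ M, A M
      · exact Or.inl (Or.inr (Set.mem_iInter.1 h' i i (by omega) ((hkM M hM).trans hi)))
      · exact Or.inr ⟨h, h'⟩
    · exact Or.inl (Or.inl h)
    · exact Or.inl (Or.inr h)
  refine (measure_mono hsub).trans ((measure_union_le _ _).trans ?_)
  have h1 := uniformMeasure_coverSet_history_union_le hP M i hi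
  rw [hcount M hM] at h1 ⊢
  rw [budget_succ]
  exact add_le_add h1 hdiff

theorem exists_le_count_history
    (hP : ∀ n, uniformMeasure (levelSet P c n) ≤ 2⁻¹ ^ (c + 1)) (k : ℕ) :
    ∃ M, k ≤ (history P c M).count true := by
  induction k with
  | zero => exact ⟨0, Nat.zero_le _⟩
  | succ k ih =>
    obtain ⟨M₀, h₀⟩ := ih
    obtain ⟨M, hM, h⟩ := exists_isAffordable hP M₀
    refine ⟨M + 1, ?_⟩
    rw [history_succ_of_isAffordable h, List.count_cons_self]
    exact Nat.succ_le_succ (h₀.trans (count_history_mono hM))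

theorem uniformMeasure_iUnion_coverSet_le
    (hP : ∀ n, uniformMeasure (levelSet P c n) ≤ 2⁻¹ ^ (c + 1)) :
    uniformMeasure (⋃ M, coverSet P c (history P c M)) ≤ 2⁻¹ ^ c := by
  rw [coverSet_history_mono.measure_iUnion]
  refine iSup_le fun M => ?_
  exact (measure_mono Set.subset_union_left).trans
    ((uniformMeasure_coverSet_history_union_le hP M M le_rfl).trans (budget_le _ _))

theorem mem_iUnion_coverSet
    (hP : ∀ n, uniformMeasure (levelSet P c n) ≤ 2⁻¹ ^ (c + 1))
    {ω : ℕ → Bool} {N : ℕ} (hω : ∀ n ≥ N, ω ∈ levelSet P c n) :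
    ω ∈ ⋃ M, coverSet P c (history P c M) := by
  obtain ⟨M, hM⟩ := exists_le_count_history hP (N + 1)
  exact Set.mem_iUnion.2 ⟨M, covered_of_lt_count hω hM⟩

end Cover

/-! ### Enumerability of the cover in the halting problem -/

section Enumeration

variable {P : ℕ × List Bool → Prop} {S : (ℕ × List Bool) × ℕ → Prop}

/-- At stage `t`, no string of length `i` witnesses that a positive decision after the history `l`
exceeds the budget. -/
def IsAffordableAt (S : (ℕ × List Bool) × ℕ → Prop) (c : ℕ) (l : List Bool) (i t : ℕ) : Prop :=
  (stringsWith i fun y => Covered (fun n => S ((c, y.take n), t)) (true :: l) ∨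
    S ((c, y), t)).length * 2 ^ (c + 1 + (l.count true + 1)) ≤
    (2 ^ (l.count true + 1 + 1) - 1) * 2 ^ i

/-- Since `i ≥ l.length`, membership depends on the first `i` bits only, so at each stage `t` the
measure is a count of strings. The increasing union over `t` obeys the bound iff every stage does.
-/
theorem isAffordable_iff (hmono : ∀ a s t, s ≤ t → S (a, s) → S (a, t))
    (hP : ∀ a, P a ↔ ∃ t, S (a, t)) (c : ℕ) (l : List Bool) :
    IsAffordable P c l ↔ ∀ r : ℕ × ℕ, IsAffordableAt S c l (l.length + r.1) r.2 := by
  have key : ∀ i ≥ l.length,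
      uniformMeasure (coverSet P c (true :: l) ∪ levelSet P c i) ≤ budget c (l.count true + 1) ↔
        ∀ t, IsAffordableAt S c l i t := by
    intro i hi
    let F : ℕ → Set (ℕ → Bool) := fun t => {ω |
      Covered (fun n => S ((c, (initialSegment ω i).take n), t)) (true :: l) ∨
        S ((c, initialSegment ω i), t)}
    have hF : Monotone F := by
      rintro s t hst ω (h | h)
      · exact Or.inl (h.mono fun n _ => hmono _ s t hst)
      · exact Or.inr (hmono _ s t hst h)
    have hU : coverSet P c (true :: l) ∪ levelSet P c i = ⋃ t, F t := by
      ext ω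
      have h1 : ω ∈ coverSet P c (true :: l) ↔
          ∃ t, Covered (fun n => S ((c, (initialSegment ω i).take n), t)) (true :: l) := by
        rw [← covered_exists_iff (S := fun n t => S ((c, (initialSegment ω i).take n), t))
          fun n => hmono _]
        refine covered_congr fun n hn => ?_
        simp only [List.length_cons] at hn
        rw [take_initialSegment ω (by omega), hP]
      have h2 : ω ∈ levelSet P c i ↔ ∃ t, S ((c, initialSegment ω i), t) := hP _
      rw [Set.mem_union, h1, h2, Set.mem_iUnion, ← exists_or]
      rfl
    rw [hU, hF.measure_iUnion, iSup_le_iff]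
    exact forall_congr' fun t => uniformMeasure_initialSegment_mem_le
      (p := fun y => Covered (fun n => S ((c, y.take n), t)) (true :: l) ∨ S ((c, y), t))
  constructor
  · intro h r
    exact (key _ (Nat.le_add_right _ _)).1 (h _ (Nat.le_add_right _ _)) r.2
  · intro h i hi
    rw [key i hi]
    intro t
    have := h (i - l.length, t)
    rwa [Nat.add_sub_cancel' hi] at this

theorem primrecPred_isAffordableAt (hS : PrimrecPred S) :
    PrimrecPred fun x : (ℕ × List Bool) × ℕ × ℕ =>
      IsAffordableAt S x.1.1 x.1.2 (x.1.2.length + x.2.1) x.2.2 := by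
  have hc : Primrec fun x : (ℕ × List Bool) × ℕ × ℕ => x.1.1 := Primrec.fst.comp Primrec.fst
  have hl : Primrec fun x : (ℕ × List Bool) × ℕ × ℕ => x.1.2 := Primrec.snd.comp Primrec.fst
  have ht : Primrec fun x : (ℕ × List Bool) × ℕ × ℕ => x.2.2 := Primrec.snd.comp Primrec.snd
  have hk : Primrec fun x : (ℕ × List Bool) × ℕ × ℕ => x.1.2.count true :=
    primrec_count_true.comp hl
  have hi : Primrec fun x : (ℕ × List Bool) × ℕ × ℕ => x.1.2.length + x.2.1 :=
    Primrec.nat_add.comp (Primrec.list_length.comp hl) (Primrec.fst.comp Primrec.snd)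
  refine Primrec.nat_le.comp (Primrec.nat_mul.comp (Primrec.list_length.comp ?_)
    (primrec_two_pow (Primrec.nat_add.comp (Primrec.succ.comp hc) (Primrec.succ.comp hk))))
    (Primrec.nat_mul.comp (Primrec.nat_sub.comp
      (primrec_two_pow (Primrec.succ.comp (Primrec.succ.comp hk))) (Primrec.const 1))
      (primrec_two_pow hi))
  refine primrec_stringsWith (p := fun z : ((ℕ × List Bool) × ℕ × ℕ) × List Bool =>
    Covered (fun n => S ((z.1.1.1, z.2.take n), z.1.2.2)) (true :: z.1.1.2) ∨
      S ((z.1.1.1, z.2), z.1.2.2)) ?_ hi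
  have hc' := hc.comp (Primrec.fst (β := List Bool))
  have ht' := ht.comp (Primrec.fst (β := List Bool))
  refine PrimrecPred.or ?_ (hS.comp ((hc'.pair Primrec.snd).pair ht'))
  refine primrecPred_covered (p := fun w : (((ℕ × List Bool) × ℕ × ℕ) × List Bool) × ℕ =>
    S ((w.1.1.1.1, w.1.2.take w.2), w.1.1.2.2)) ?_
    (Primrec.list_cons.comp (Primrec.const true) (hl.comp Primrec.fst))
  exact hS.comp (((hc'.comp Primrec.fst).pair (Primrec.list_take.comp Primrec.snd
    (Primrec.snd.comp Primrec.fst))).pair (ht'.comp Primrec.fst))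

/-- Each decision is checked against the tail of `b` itself, so a guessed history is verified by
finitely many equivalences between a decidable and a `Π₁` condition. -/
theorem eq_history_iff {c : ℕ} {b : List Bool} : b = history P c b.length ↔
    ∀ j < b.length, (b.getD j false = true ↔ IsAffordable P c (b.drop (j + 1))) := by
  induction b with
  | nil => simp [history]
  | cons a l ih =>
    simp only [List.length_cons, history, List.cons.injEq]
    constructor
    · rintro ⟨ha, hl⟩ j hj
      cases j with
      | zero => simp only [List.getD_cons_zero, zero_add, List.drop_succ_cons, List.drop_zero]
                rw [← hl] at ha
                simp [ha]
      | succ j => simpa using ih.1 hl j (by omega)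
    · intro h
      have hl := ih.2 fun j hj => by simpa using h (j + 1) (by omega)
      refine ⟨?_, hl⟩
      have := h 0 (by omega)
      simp only [List.getD_cons_zero, zero_add, List.drop_succ_cons, List.drop_zero] at this
      rw [← hl, Bool.eq_iff_iff, this]
      simp

/-- The strings that span the covers. -/
def coverStrings (P : ℕ × List Bool → Prop) : Set (ℕ × List Bool) :=
  {a | Covered (fun n => P (a.1, a.2.take n)) (history P a.1 a.2.length)}

theorem openSection_coverStrings (c : ℕ) :
    openSection (coverStrings P) c = ⋃ M, coverSet P c (history P c M) := by
  have h : ∀ (ω : ℕ → Bool) (M : ℕ), (c, initialSegment ω M) ∈ coverStrings P ↔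
      ω ∈ coverSet P c (history P c M) := by
    intro ω M
    simp only [coverStrings, coverSet, Set.mem_ofPred_eq, length_initialSegment]
    refine covered_congr fun n hn => ?_
    rw [length_history] at hn
    rw [take_initialSegment ω hn.le]
  ext ω
  simp only [openSection, Set.mem_iUnion, Set.mem_ofPred_eq, exists_prop, ← h]
  constructor
  · rintro ⟨x, hx, hω⟩
    exact ⟨x.length, by rwa [mem_cylinder.1 hω]⟩
  · rintro ⟨M, hM⟩
    exact ⟨_, hM, by simp [mem_cylinder]⟩

theorem isSigma2_coverStrings (hP : REPred P) : IsSigma2 fun a => a ∈ coverStrings P := by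
  obtain ⟨S, hS, hmono, hPS⟩ := exists_primrec_stages hP
  have hhist : IsSigma2 fun z : (ℕ × List Bool) × List Bool =>
      ∀ j < z.2.length,
        (z.2.getD j false = true ↔ IsAffordable P z.1.1 (z.2.drop (j + 1))) := by
    have hb : Primrec fun w : ((ℕ × List Bool) × List Bool) × ℕ => w.1.2 :=
      Primrec.snd.comp Primrec.fst
    refine IsSigma2.forall_lt (p := fun w : ((ℕ × List Bool) × List Bool) × ℕ =>
      (w.1.2.getD w.2 false = true ↔ IsAffordable P w.1.1.1 (w.1.2.drop (w.2 + 1)))) ?_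
      (Primrec.list_length.comp Primrec.snd)
    refine (isSigma2_iff_forall (β := ℕ × ℕ) (Primrec.eq.comp
      ((Primrec.list_getD false).comp hb Primrec.snd) (Primrec.const true))
      ((primrecPred_isAffordableAt hS).comp
      (f := fun v : (((ℕ × List Bool) × List Bool) × ℕ) × ℕ × ℕ =>
        ((v.1.1.1.1, v.1.1.2.drop (v.1.2 + 1)), v.2)) ?_)).of_eq fun w => ?_
    · exact (((Primrec.fst.comp (Primrec.fst.comp Primrec.fst)).comp Primrec.fst).pair
        (Primrec.list_drop.comp (Primrec.succ.comp (Primrec.snd.comp Primrec.fst))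
          (hb.comp Primrec.fst))).pair Primrec.snd
    · rw [isAffordable_iff hmono hPS]
  have hcov : IsSigma2 fun z : (ℕ × List Bool) × List Bool =>
      ∃ t, Covered (fun n => S ((z.1.1, z.1.2.take n), t)) z.2 := by
    refine IsSigma2.exists (p := fun w : ((ℕ × List Bool) × List Bool) × ℕ =>
      Covered (fun n => S ((w.1.1.1, w.1.1.2.take n), w.2)) w.1.2) (isSigma2_of_primrecPred ?_)
    refine primrecPred_covered (p := fun v : (((ℕ × List Bool) × List Bool) × ℕ) × ℕ =>
      S ((v.1.1.1.1, v.1.1.1.2.take v.2), v.1.2)) ?_ (Primrec.snd.comp Primrec.fst)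
    have ha : Primrec fun v : (((ℕ × List Bool) × List Bool) × ℕ) × ℕ => v.1.1.1 :=
      Primrec.fst.comp (Primrec.fst.comp Primrec.fst)
    exact hS.comp (((Primrec.fst.comp ha).pair (Primrec.list_take.comp Primrec.snd
      (Primrec.snd.comp ha))).pair (Primrec.snd.comp Primrec.fst))
  have hlen : IsSigma2 fun z : (ℕ × List Bool) × List Bool => z.2.length = z.1.2.length :=
    isSigma2_of_primrecPred (Primrec.eq.comp (Primrec.list_length.comp Primrec.snd)
      (Primrec.list_length.comp (Primrec.snd.comp Primrec.fst)))
  refine ((hlen.and hhist).and hcov).exists.of_eq fun a => ?_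
  simp only [← eq_history_iff,
    ← covered_exists_iff (S := fun n t => S ((a.1, a.2.take n), t)) fun n => hmono _, ← hPS]
  constructor
  · rintro ⟨b, ⟨hl, hb⟩, h⟩
    rw [hb, hl] at h
    exact h
  · intro h
    exact ⟨history P a.1 a.2.length, ⟨by simp, by simp⟩, h⟩

end Enumeration

/-- For a uniformly enumerable family of open sets `V c n`, the `n`-th of which is a union of
intervals of length `n` and has measure at most `2⁻⁽ᶜ⁺¹⁾`, the lower limits in `n` are covered by
a Martin-Löf test relative to the halting problem. -/
theorem isMartinLofTestIn_coverStrings {P : ℕ × List Bool → Prop} (hP : REPred P)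
    (hμ : ∀ c n, uniformMeasure (levelSet P c n) ≤ 2⁻¹ ^ (c + 1)) :
    IsMartinLofTestIn zeroJump (coverStrings P) :=
  ⟨(isSigma2_coverStrings hP).enumerableIn, fun c => by
    rw [openSection_coverStrings]
    exact uniformMeasure_iUnion_coverSet_le (hμ c)⟩

theorem infinite_of_isMartinLofRandomIn {D : List Bool →. List Bool} (hD : Partrec D)
    {ω : ℕ → Bool} (h : IsMartinLofRandomIn zeroJump ω) :
    ∃ c : ℕ, {n : ℕ | (n : ℕ∞) ≤ complexity D (initialSegment ω n) + c}.Infinite := by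
  by_contra! hfin
  have hμ : ∀ c n, uniformMeasure (levelSet (fun x : ℕ × List Bool =>
      complexity D x.2 + (x.1 + 1 : ℕ) < x.2.length) c n) ≤ 2⁻¹ ^ (c + 1) := fun c n =>
    uniformMeasure_complexity_add_lt D (c + 1) n
  refine h _ (isMartinLofTestIn_coverStrings (rePred_complexity_add_lt hD) hμ)
    (Set.mem_iInter.2 fun c => ?_)
  rw [openSection_coverStrings]
  -- Level `c` uses the constant `c + 1`, as its open sets must have measure at most `2⁻⁽ᶜ⁺¹⁾`;
  -- every length above `N` is compressible by that much.
  obtain ⟨N, hN⟩ := (hfin (c + 1)).bddAbove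
  refine mem_iUnion_coverSet (hμ c) (N := N + 1) fun n hn => ?_
  simp only [levelSet, Set.mem_ofPred_eq, length_initialSegment]
  by_contra hle
  have := hN (a := n) (not_lt.1 hle)
  omega

end AlgorithmicRandomness

theorem theorem10 (D : List Bool →. List Bool) (hD : AlgorithmicRandomness.IsOptimal D)
    (ω : ℕ → Bool) :
    AlgorithmicRandomness.IsMartinLofRandomIn AlgorithmicRandomness.zeroJump ω ↔
      ∃ c : ℕ, {n : ℕ | (n : ℕ∞) ≤
        AlgorithmicRandomness.complexity D (AlgorithmicRandomness.initialSegment ω n) + c}.Infinite :=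
  ⟨AlgorithmicRandomness.infinite_of_isMartinLofRandomIn hD.1,
    fun ⟨_, h⟩ => AlgorithmicRandomness.isMartinLofRandomIn_of_infinite hD h⟩
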